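/- Let $N\ge 2$ and let $\vec p=(p_1,\dots,p_N)$ be real numbers with $p_i>1$ for all $i$ and $\sum_{i=1}^N \frac1{p_i}>1$. Put $p^*=\dfrac{N}{\sum_{i=1}^N \frac1{p_i}-1}$ and assume $\max_i p_i<p^*$. Let $\mathcal D^{1,\vec p}(\mathbb R^N)\subset L^{p^*}(\mathbb R^N)$ be the completion of $C_c^\infty(\mathbb R^N)$ with respect to the norm $\sum_{i=1}^N\left\|\frac{\partial u}{\partial x_i}\right\|_{L^{p_i}(\mathbb R^N)}$, realised as a space of functions through its continuous embedding into $L^{p^*}(\mathbb R^N)$. Consider real-valued solutions $u\in\mathcal D^{1,\vec p}(\mathbb R^N)$, in the sense of distributions, of $$-\sum_{i=1}^N\frac{\partial}{\partial x_i}\left(\left|\frac{\partial u}{\partial x_i}\right|^{p_i-2}\frac{\partial u}{\partial x_i}\right)=|u|^{p^*-2}u\quad\text{in }\mathbb R^N .\tag{1}$$ (a) Every solution $u\in\mathcal D^{1,\vec p}(\mathbb R^N)$ of (1) with $u\ge 0$ almost everywhere belongs to $L^\infty(\mathbb R^N)$. (b) There is a number $\tau_0>0$, depending only on $N$ and $p_1,\dots,p_N$,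 such that every solution $u\in\mathcal D^{1,\vec p}(\mathbb R^N)$ of (1) that is not almost everywhere zero satisfies $\|u\|_{L^{p^*}(\mathbb R^N)}\ge\tau_0$. -/

import Mathlib

open MeasureTheory Filter Topology
open scoped ContDiff

/-- Real-valued test functions on `ℝ^N`: smooth with compact support. -/
def IsTestFunction {N : ℕ} (φ : EuclideanSpace ℝ (Fin N) → ℝ) : Prop :=
  ContDiff ℝ ∞ φ ∧ HasCompactSupport φ

/-- The classical partial derivative `∂φ/∂x_i` (used for smooth functions only). -/
noncomputable def partialDeriv {N : ℕ} (i : Fin N) (φ : EuclideanSpace ℝ (Fin N) → ℝ)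
    (x : EuclideanSpace ℝ (Fin N)) : ℝ :=
  fderiv ℝ φ x (EuclideanSpace.single i 1)

/-- The critical exponent `p* = N / (∑ 1/p_i - 1)`. -/
noncomputable def criticalExponent {N : ℕ} (p : Fin N → ℝ) : ℝ :=
  (N : ℝ) / ((∑ i, 1 / p i) - 1)

/-- `g` is the weak (distributional) partial derivative `∂u/∂x_i` on `ℝ^N`. -/
def HasWeakPartialDeriv {N : ℕ} (i : Fin N) (u g : EuclideanSpace ℝ (Fin N) → ℝ) : Prop :=
  LocallyIntegrable u ∧ LocallyIntegrable g ∧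
    ∀ φ : EuclideanSpace ℝ (Fin N) → ℝ, IsTestFunction φ →
      ∫ x, u x * partialDeriv i φ x = - ∫ x, g x * φ x

/-- The anisotropic Sobolev space `D^{1,p}(ℝ^N)`: the completion of the test functions for the norm
`φ ↦ ∑ i, ‖∂φ/∂x_i‖_{p_i}`, realised as a space of functions through its embedding into
`L^{p*}(ℝ^N)`. Thus `u` belongs to it when `u` is the limit in `L^{p*}` of test functions `φ n`
whose partial derivatives converge in `L^{p_i}`, for every `i`. -/
def MemAnisotropicSobolev {N : ℕ} (p : Fin N → ℝ) (u : EuclideanSpace ℝ (Fin N) → ℝ) : Prop :=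
  MemLp u (ENNReal.ofReal (criticalExponent p)) ∧
    ∃ φ : ℕ → EuclideanSpace ℝ (Fin N) → ℝ, (∀ n, IsTestFunction (φ n)) ∧
      Tendsto (fun n => eLpNorm (fun x => φ n x - u x)
        (ENNReal.ofReal (criticalExponent p)) volume) atTop (𝓝 0) ∧
      ∀ i, ∃ g : EuclideanSpace ℝ (Fin N) → ℝ, MemLp g (ENNReal.ofReal (p i)) ∧
        Tendsto (fun n => eLpNorm (fun x => partialDeriv i (φ n) x - g x)
          (ENNReal.ofReal (p i)) volume) atTop (𝓝 0)

/-- `u ∈ D^{1,p}(ℝ^N)` solves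
`-∑ i, ∂_i (|∂_i u|^(p_i - 2) ∂_i u) = |u|^(p* - 2) u` in the sense of distributions on `ℝ^N`.
Here `Du i` is the weak partial derivative `∂_i u`, which is unique almost everywhere. -/
def IsCriticalAnisotropicSolution {N : ℕ} (p : Fin N → ℝ)
    (u : EuclideanSpace ℝ (Fin N) → ℝ) : Prop :=
  MemAnisotropicSobolev p u ∧
    ∃ Du : Fin N → EuclideanSpace ℝ (Fin N) → ℝ, (∀ i, HasWeakPartialDeriv i u (Du i)) ∧
      ∀ φ : EuclideanSpace ℝ (Fin N) → ℝ, IsTestFunction φ →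
        ∑ i, ∫ x, |Du i x| ^ (p i - 2) * Du i x * partialDeriv i φ x =
          ∫ x, |u x| ^ (criticalExponent p - 2) * u x * φ x

/-! The anisotropic Sobolev inequality `‖v‖_{p*} ≤ C ∑ ‖∂ᵢv‖_{pᵢ}` is played against the equation
tested with `G(u)`, where `G 0 = 0` and `0 ≤ G' ≤ 1`. Testing bounds every `∫ G'(u)|∂ᵢu|^{pᵢ}` by `I
= ∫ |u|^{p*-1}|G(u)|`; since `(G')^{pᵢ} ≤ G'`, Sobolev gives `‖G(u)‖_{p*} ≤ C ∑ I^{1/pᵢ}`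
(`IsCriticalAnisotropicSolution.eLpNorm_comp_le`). If `I ≤ D y^{p*}` with `y ≤ 1`, the right side is
`O(y^r)` with `r = min p*/pᵢ`, and `max pᵢ < p*` makes `r > 1`. This superlinear gain drives both
claims.

For (b), take `G = id` and `y = ‖u‖`: if `y ≤ 1` then `y ≤ A y^r`, so a nonzero `y` cannot be small.

For (a), `G` is a smooth truncation between levels `k < h` and `y = ‖(u-k)₊‖`. The resulting step
(`eLpNorm_truncation_le`) is iterated à la De Giorgi along levels increasing from `K` to `2K`. Its
constants depend on the levels only through `h/(h-k)`, so the smallness threshold is independent of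
`K`, and `K` can be taken so large that `‖(u-K)₊‖` lies below it.

Sobolev's inequality itself follows from a Loomis–Whitney type inequality applied to a different
power of `|φ|` in each direction. Testing with `G(u)` is justified through test functions `φₙ → u`,
since `G(φₙ)` is again a test function. -/

/-! ### Troisi's anisotropic Sobolev inequality for test functions. -/

section SobolevTest

open scoped ENNReal

/-- A compactly supported `C¹` function is bounded by the integral of its partial derivative along
the coordinate line. -/
theorem enorm_le_lintegral_fderiv_single {ι : Type*} [Fintype ι] [DecidableEq ι]
    {v : (ι → ℝ) → ℝ} (hv : ContDiff ℝ 1 v) (hc : HasCompactSupport v) (i : ι) (x : ι → ℝ) :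
    ‖v x‖ₑ ≤ ∫⁻ t, ‖fderiv ℝ v (Function.update x i t) (Pi.single i 1)‖ₑ := by
  calc ‖v x‖ₑ
    _ ≤ ∫⁻ t in Set.Iic (x i), ‖deriv (v ∘ Function.update x i) t‖ₑ := by
        apply le_trans (by simp) (HasCompactSupport.enorm_le_lintegral_Ici_deriv _ _ _)
        · exact hv.comp (by convert! contDiff_update 1 x i)
        · exact hc.comp_isClosedEmbedding (isClosedEmbedding_update x i)
    _ ≤ ∫⁻ t, ‖deriv (v ∘ Function.update x i) t‖ₑ := setLIntegral_le_lintegral _ _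
    _ = _ := by
        congr! with t
        rw [fderiv_comp_deriv _ (hv.differentiable one_ne_zero).differentiableAt
          (hasDerivAt_update x i t).differentiableAt, deriv_update]

/-- A Loomis–Whitney type inequality: the grid-lines lemma with one function per direction. -/
theorem lintegral_prod_enorm_rpow_le_pi {ι : Type*} [Fintype ι] [DecidableEq ι] {q : ℝ}
    (hq : Real.HolderConjugate (Fintype.card ι) q) {v : ι → (ι → ℝ) → ℝ}
    (hv : ∀ i, ContDiff ℝ 1 (v i)) (hc : ∀ i, HasCompactSupport (v i)) (c : ι → ℝ≥0∞) :
    ∫⁻ x, ∏ i, (c i * ‖v i x‖ₑ) ^ (1 / ((Fintype.card ι : ℝ) - 1)) ≤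
      (∑ i, c i * ∫⁻ x, ‖fderiv ℝ (v i) x (Pi.single i 1)‖ₑ) ^ q := by
  have h1 : (1 : ℝ) < Fintype.card ι := hq.lt
  have hm : ∀ i, Measurable fun x => ‖fderiv ℝ (v i) x (Pi.single i 1)‖ₑ := fun i =>
    (((hv i).continuous_fderiv one_ne_zero).clm_apply continuous_const).measurable.enorm
  -- The grid-lines lemma takes a single integrand; the sum over all directions dominates each
  -- directional one, which costs only a sum on the right.
  set f : (ι → ℝ) → ℝ≥0∞ := fun x => ∑ i, c i * ‖fderiv ℝ (v i) x (Pi.single i 1)‖ₑ with hf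
  have hfm : Measurable f := Finset.measurable_sum _ fun i _ => (hm i).const_mul _
  calc _ ≤ ∫⁻ x, ∏ i, (∫⁻ t, f (Function.update x i t)) ^ (1 / ((Fintype.card ι : ℝ) - 1)) := by
        refine lintegral_mono fun x => Finset.prod_le_prod' fun i _ => ?_
        refine ENNReal.rpow_le_rpow ?_ (one_div_nonneg.2 (by linarith))
        calc _ ≤ c i * ∫⁻ t, ‖fderiv ℝ (v i) (Function.update x i t) (Pi.single i 1)‖ₑ := by
              gcongr
              exact enorm_le_lintegral_fderiv_single (hv i) (hc i) i x
          _ = ∫⁻ t, c i * ‖fderiv ℝ (v i) (Function.update x i t) (Pi.single i 1)‖ₑ :=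
              (lintegral_const_mul _ ((hm i).comp (measurable_update x))).symm
          _ ≤ _ := lintegral_mono fun t => by
              exact Finset.single_le_sum_of_canonicallyOrdered
                (f := fun j => c j * ‖fderiv ℝ (v j) (Function.update x i t) (Pi.single j 1)‖ₑ)
                (Finset.mem_univ i)
    _ ≤ (∫⁻ x, f x) ^ q := lintegral_prod_lintegral_pow_le (fun _ => volume) hq hfm
    _ = _ := by
        rw [hf, lintegral_finsetSum _ fun i _ => (hm i).const_mul _]
        simp_rw [lintegral_const_mul _ (hm _)]

theorem lintegral_prod_enorm_rpow_le {N : ℕ} {q : ℝ} (hq : Real.HolderConjugate N q)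
    {v : Fin N → EuclideanSpace ℝ (Fin N) → ℝ}
    (hv : ∀ i, ContDiff ℝ 1 (v i)) (hc : ∀ i, HasCompactSupport (v i)) (c : Fin N → ℝ≥0∞) :
    ∫⁻ x, ∏ i, (c i * ‖v i x‖ₑ) ^ (1 / ((N : ℝ) - 1)) ≤
      (∑ i, c i * ∫⁻ x, ‖partialDeriv i (v i) x‖ₑ) ^ q := by
  let e := (EuclideanSpace.equiv (Fin N) ℝ).symm
  have key := lintegral_prod_enorm_rpow_le_pi (ι := Fin N) (q := q) (by simpa using hq)
    (v := fun i => v i ∘ e) (fun i => (hv i).comp e.contDiff)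
    (fun i => (hc i).comp_homeomorph e.toHomeomorph) c
  have hT : MeasurePreserving (MeasurableEquiv.toLp 2 (Fin N → ℝ)) :=
    PiLp.volume_preserving_toLp (Fin N)
  have hd : ∀ i y, fderiv ℝ (v i ∘ e) y (Pi.single i 1) = partialDeriv i (v i) (e y) := by
    intro i y
    rw [fderiv_comp y ((hv i).differentiable one_ne_zero _) e.differentiableAt, e.fderiv]
    rfl
  simp only [hd, Fintype.card_fin] at key
  rw [← hT.lintegral_comp_emb (MeasurableEquiv.measurableEmbedding _)]
  simp_rw [← hT.lintegral_comp_emb (MeasurableEquiv.measurableEmbedding _)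
    (fun x => ‖partialDeriv _ (v _) x‖ₑ)]
  exact key

theorem ENNReal.prod_rpow_eq_rpow_sum {ι : Type*} {s : Finset ι} {f : ι → ℝ} {a : ℝ≥0∞}
    (ha : a ≠ 0) (ha' : a ≠ ⊤) : ∏ i ∈ s, a ^ f i = a ^ ∑ i ∈ s, f i := by
  classical
  induction s using Finset.induction_on with
  | empty => simp
  | insert i s hi ih => rw [Finset.prod_insert hi, Finset.sum_insert hi,
      ENNReal.rpow_add _ _ ha ha', ih]

theorem ENNReal.prod_rpow_eq_rpow_sum_of_nonneg {ι : Type*} {s : Finset ι} {f : ι → ℝ} {a : ℝ≥0∞}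
    (hf : ∀ i ∈ s, 0 ≤ f i) : ∏ i ∈ s, a ^ f i = a ^ ∑ i ∈ s, f i := by
  classical
  induction s using Finset.induction_on with
  | empty => simp
  | insert i s hi ih =>
    rw [Finset.forall_mem_insert] at hf
    rw [Finset.prod_insert hi, Finset.sum_insert hi,
      ENNReal.rpow_add_of_nonneg _ _ hf.1 (Finset.sum_nonneg hf.2), ih hf.2]

theorem sum_one_div_eq_of_criticalExponent {N : ℕ} (hN : 2 ≤ N) (p : Fin N → ℝ) :
    ∑ i, 1 / p i = 1 + N / criticalExponent p := by
  have : (0 : ℝ) < N := by positivity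
  rw [criticalExponent, div_div_cancel₀ this.ne']; ring

theorem criticalExponent_pos {N : ℕ} (hN : 2 ≤ N) {p : Fin N → ℝ}
    (hsum : 1 < ∑ i, 1 / p i) : 0 < criticalExponent p :=
  div_pos (by positivity) (by linarith)

/-- The derivative of `|φ|^γ` is `γ |φ|^{P/p'} |∂ᵢφ|` in modulus, with `p'` conjugate to `p`; the
exponent `γ` is chosen so that Hölder turns the first factor into a power of `∫ |φ|^P`. Bounding `γ
≤ 1 + P` makes the constant the same in all directions. -/
theorem lintegral_enorm_partialDeriv_rpow_le {N : ℕ} (i : Fin N)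
    {φ : EuclideanSpace ℝ (Fin N) → ℝ} (hφ : IsTestFunction φ) {p P : ℝ} (hp : 1 < p)
    (hP : 0 < P) :
    ∫⁻ x, ‖partialDeriv i (fun x => ‖φ x‖ ^ (1 + P * (1 - 1 / p))) x‖ₑ ≤
      ENNReal.ofReal (1 + P) * ((∫⁻ x, ‖φ x‖ₑ ^ P) ^ (1 - 1 / p) *
        eLpNorm (partialDeriv i φ) (ENNReal.ofReal p) volume) := by
  have hp0 : 0 < p := by linarith
  have hinv : 1 / p < 1 := by rw [div_lt_one hp0]; exact hp
  have hs : 0 < 1 - 1 / p := by linarith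
  have hinv' : 0 < 1 / p := by positivity
  set γ := 1 + P * (1 - 1 / p) with hγ
  have hγ1 : 1 < γ := by have := mul_pos hP hs; linarith
  have hφd : Differentiable ℝ φ := hφ.1.differentiable (by simp)
  have hm : Measurable φ := hφ.1.continuous.measurable
  have hm' : Measurable (partialDeriv i φ) :=
    ((hφ.1.continuous_fderiv (by simp)).clm_apply continuous_const).measurable
  have hpt : ∀ x, ‖partialDeriv i (fun x => ‖φ x‖ ^ γ) x‖ₑ ≤
      ENNReal.ofReal (1 + P) * (‖φ x‖ₑ ^ (P * (1 - 1 / p)) * ‖partialDeriv i φ x‖ₑ) := by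
    intro x
    have h1 : ‖partialDeriv i (fun x => ‖φ x‖ ^ γ) x‖ =
        γ * (‖φ x‖ ^ (P * (1 - 1 / p)) * ‖partialDeriv i φ x‖) := by
      rw [partialDeriv, hφd.fderiv_norm_rpow hγ1]
      simp only [smul_apply, ContinuousLinearMap.comp_apply, norm_smul,
        innerSL_apply_apply, partialDeriv]
      rw [real_inner_comm, RCLike.inner_apply, conj_trivial, norm_mul, norm_mul,
        Real.norm_of_nonneg (by linarith : 0 ≤ γ),
        Real.norm_of_nonneg (by positivity : 0 ≤ ‖φ x‖ ^ (γ - 2)), mul_assoc, ← mul_assoc (_ ^ _),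
        ← Real.rpow_add_one' (norm_nonneg _) (by linarith)]
      congr 3
      rw [hγ]; ring
    have h2 : γ ≤ 1 + P := by
      have : P * (1 - 1 / p) ≤ P * 1 := by gcongr; linarith
      linarith
    rw [← ofReal_norm, ← ofReal_norm, ← ofReal_norm, h1,
      ENNReal.ofReal_rpow_of_nonneg (norm_nonneg _) (by positivity),
      ← ENNReal.ofReal_mul (by positivity), ← ENNReal.ofReal_mul (by linarith)]
    gcongr
  have hpq : Real.HolderConjugate (1 - 1 / p)⁻¹ p := by
    rw [Real.holderConjugate_iff]
    refine ⟨(one_lt_inv₀ hs).2 (by linarith), ?_⟩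
    rw [inv_inv]; simp
  calc _ ≤ ∫⁻ x, ENNReal.ofReal (1 + P) *
        (‖φ x‖ₑ ^ (P * (1 - 1 / p)) * ‖partialDeriv i φ x‖ₑ) := lintegral_mono hpt
    _ = ENNReal.ofReal (1 + P) * ∫⁻ x, ‖φ x‖ₑ ^ (P * (1 - 1 / p)) * ‖partialDeriv i φ x‖ₑ :=
        lintegral_const_mul _ ((hm.enorm.pow_const _).mul hm'.enorm)
    _ ≤ _ := by
        gcongr
        refine (ENNReal.lintegral_mul_le_Lp_mul_Lq volume hpq
          (hm.enorm.pow_const _).aemeasurable hm'.enorm.aemeasurable).trans_eq ?_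
        rw [eLpNorm_eq_lintegral_rpow_enorm_toReal (by simpa using hp0) (by simp),
          ENNReal.toReal_ofReal hp0.le]
        simp only [← ENNReal.rpow_mul, mul_assoc, mul_inv_cancel₀ hs.ne', mul_one]
        rw [one_div (_⁻¹), inv_inv]

/-- **Anisotropic Sobolev inequality** (Troisi) for test functions. -/
theorem eLpNorm_le_sum_eLpNorm_partialDeriv {N : ℕ} (hN : 2 ≤ N) {p : Fin N → ℝ}
    (hp : ∀ i, 1 < p i) (hsum : 1 < ∑ i, 1 / p i)
    {φ : EuclideanSpace ℝ (Fin N) → ℝ} (hφ : IsTestFunction φ) :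
    eLpNorm φ (ENNReal.ofReal (criticalExponent p)) volume ≤
      ENNReal.ofReal (1 + criticalExponent p) *
        ∑ i, eLpNorm (partialDeriv i φ) (ENNReal.ofReal (p i)) volume := by
  have hP := criticalExponent_pos hN hsum
  have hs := sum_one_div_eq_of_criticalExponent hN p
  set P := criticalExponent p with hPdef
  have hN2 : (2 : ℝ) ≤ N := by exact_mod_cast hN
  have hN1 : (0 : ℝ) < N - 1 := by linarith
  have hφm : Measurable φ := hφ.1.continuous.measurable
  rw [eLpNorm_eq_lintegral_rpow_enorm_toReal (by simpa using hP) (by simp),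
    ENNReal.toReal_ofReal hP.le]
  set J := ∫⁻ x, ‖φ x‖ₑ ^ P with hJ
  by_cases hJ0 : J = 0
  · rw [hJ0, ENNReal.zero_rpow_of_pos (by positivity)]; exact zero_le
  have hJt : J ≠ ⊤ := by
    have := (hφ.1.continuous.memLp_of_hasCompactSupport (p := ENNReal.ofReal P)
      (μ := volume) hφ.2).eLpNorm_lt_top
    rw [eLpNorm_eq_lintegral_rpow_enorm_toReal (by simpa using hP) (by simp),
      ENNReal.toReal_ofReal hP.le] at this
    intro h
    rw [← hJ, h, ENNReal.top_rpow_of_pos (by positivity)] at this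
    exact lt_irrefl _ this
  set D := fun i => eLpNorm (partialDeriv i φ) (ENNReal.ofReal (p i)) volume with hD
  -- `s` is the mean of the numbers `1 - 1/pᵢ`. The weights `J^(s - (1 - 1/pᵢ))` used below
  -- therefore multiply to 1, while they equalise the powers of `J` that Hölder produces in the
  -- different directions.
  set s : ℝ := (N - 1 - N / P) / N with hsdef
  have hsumr : ∑ i, (1 - 1 / p i) = N - 1 - N / P := by
    rw [Finset.sum_sub_distrib, hs]; simp; ring
  have hq : Real.HolderConjugate N (N / (N - 1)) := by
    rw [Real.holderConjugate_iff]
    refine ⟨by linarith, ?_⟩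
    field_simp; ring
  have key := lintegral_prod_enorm_rpow_le hq
    (v := fun i x => ‖φ x‖ ^ (1 + P * (1 - 1 / p i)))
    (fun i => (hφ.1.of_le (by simp)).norm_rpow (by
      have : 0 < 1 - 1 / p i := by
        have := (div_lt_one (by linarith [hp i])).2 (hp i); linarith
      have := mul_pos hP this
      linarith))
    (fun i => by
      refine hφ.2.comp_left (g := fun t => ‖t‖ ^ (1 + P * (1 - 1 / p i))) ?_
      have : 0 < 1 - 1 / p i := by
        have := (div_lt_one (by linarith [hp i])).2 (hp i); linarith
      simp only [norm_zero]
      exact Real.zero_rpow (by positivity))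
    (fun i => J ^ (s - (1 - 1 / p i)))
  -- The weights cancel, and the powers add up to `∑ (1 + P(1 - 1/pᵢ)) = P(N - 1)`, by the
  -- definition of the critical exponent.
  have hL : ∀ x, ∏ i, (J ^ (s - (1 - 1 / p i)) * ‖‖φ x‖ ^ (1 + P * (1 - 1 / p i))‖ₑ)
      ^ (1 / ((N : ℝ) - 1)) = ‖φ x‖ₑ ^ P := by
    intro x
    have hpos : ∀ i, 0 < 1 - 1 / p i := fun i => by
      have := (div_lt_one (by linarith [hp i])).2 (hp i); linarith
    rw [ENNReal.prod_rpow_of_nonneg (by positivity), Finset.prod_mul_distrib,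
      ENNReal.prod_rpow_eq_rpow_sum hJ0 hJt]
    have h0 : ∑ i, (s - (1 - 1 / p i)) = 0 := by
      rw [Finset.sum_sub_distrib, hsumr]; simp [hsdef]; field_simp; simp
    rw [h0, ENNReal.rpow_zero, one_mul]
    have : ∀ i, ‖‖φ x‖ ^ (1 + P * (1 - 1 / p i))‖ₑ = ‖φ x‖ₑ ^ (1 + P * (1 - 1 / p i)) := by
      intro i
      have := mul_pos hP (hpos i)
      rw [Real.enorm_of_nonneg (by positivity), ← ofReal_norm,
        ENNReal.ofReal_rpow_of_nonneg (norm_nonneg _) (by linarith)]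
    simp_rw [this]
    rw [ENNReal.prod_rpow_eq_rpow_sum_of_nonneg (fun i _ => by have := mul_pos hP (hpos i); linarith),
      ← ENNReal.rpow_mul]
    congr 1
    rw [Finset.sum_add_distrib, ← Finset.mul_sum, hsumr]
    simp
    field_simp
    ring
  simp_rw [hL] at key
  have hR : ∑ i, J ^ (s - (1 - 1 / p i)) *
      ∫⁻ x, ‖partialDeriv i (fun x => ‖φ x‖ ^ (1 + P * (1 - 1 / p i))) x‖ₑ ≤
      J ^ s * (ENNReal.ofReal (1 + P) * ∑ i, D i) := by
    rw [Finset.mul_sum, Finset.mul_sum]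
    refine Finset.sum_le_sum fun i _ => ?_
    calc _ ≤ J ^ (s - (1 - 1 / p i)) * (ENNReal.ofReal (1 + P) * (J ^ (1 - 1 / p i) * D i)) := by
          gcongr
          exact lintegral_enorm_partialDeriv_rpow_le i hφ (hp i) hP
      _ = (J ^ (s - (1 - 1 / p i)) * J ^ (1 - 1 / p i)) * (ENNReal.ofReal (1 + P) * D i) := by ring
      _ = _ := by rw [← ENNReal.rpow_add _ _ hJ0 hJt]; congr 2; ring
  set S := ENNReal.ofReal (1 + P) * ∑ i, D i with hS
  have h1 : J ≤ J ^ (1 - N / P / (N - 1)) * S ^ ((N : ℝ) / (N - 1)) := by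
    refine (key.trans (ENNReal.rpow_le_rpow hR (by positivity))).trans_eq ?_
    rw [ENNReal.mul_rpow_of_nonneg _ _ (by positivity), ← ENNReal.rpow_mul]
    congr 2
    rw [hsdef]; field_simp
  -- The power of `J` on the right is absorbed; this needs `J` nonzero and finite.
  have h2 : J ^ (N / P / (N - 1)) ≤ S ^ ((N : ℝ) / (N - 1)) := by
    have hne : J ^ (1 - N / P / (N - 1)) ≠ 0 := by simp [hJ0, hJt]
    have hnt : J ^ (1 - N / P / (N - 1)) ≠ ⊤ := by simp [hJ0, hJt]
    rw [← ENNReal.mul_le_mul_iff_right hne hnt, ← ENNReal.rpow_add _ _ hJ0 hJt]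
    simpa using h1
  have h3 : (J ^ (1 / P)) ^ ((N : ℝ) / (N - 1)) ≤ S ^ ((N : ℝ) / (N - 1)) := by
    rw [← ENNReal.rpow_mul]
    convert h2 using 2
    field_simp
  exact (ENNReal.rpow_le_rpow_iff (by positivity)).1 h3

end SobolevTest

/-! ### Passage to the limit in duality pairings. -/

section Limits

open scoped ENNReal

variable {α : Type*} {m : MeasurableSpace α} {μ : Measure α}

/-- Convergence of `∫ F θₙ fₙ` when `fₙ → f` in `L^p`, `F ∈ L^q` and `θₙ` is bounded and converges
almost everywhere. -/
theorem tendsto_integral_mul_mul {p q : ℝ≥0∞} [hpq : q.HolderConjugate p] {F f θ : α → ℝ}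
    {fn θn : ℕ → α → ℝ} (hF : MemLp F q μ) (hf : MemLp f p μ) (hfn : ∀ n, MemLp (fn n) p μ)
    (hlim : Tendsto (fun n => eLpNorm (fun x => fn n x - f x) p μ) atTop (𝓝 0))
    (hθm : ∀ n, AEStronglyMeasurable (θn n) μ) (hθ1 : ∀ n x, |θn n x| ≤ 1)
    (hθ : ∀ᵐ x ∂μ, Tendsto (fun n => θn n x) atTop (𝓝 (θ x))) :
    Tendsto (fun n => ∫ x, F x * (θn n x * fn n x) ∂μ) atTop
      (𝓝 (∫ x, F x * (θ x * f x) ∂μ)) := by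
  have hint : ∀ n {g : α → ℝ}, MemLp g p μ → Integrable (fun x => F x * (θn n x * g x)) μ := by
    intro n g hg
    have hg' : MemLp (fun x => θn n x * g x) p μ := by
      refine hg.of_le ((hθm n).mul hg.1) (ae_of_all _ fun x => ?_)
      rw [norm_mul]
      exact mul_le_of_le_one_left (norm_nonneg _) (hθ1 n x)
    exact hF.integrable_mul hg'
  -- With `f` fixed and only `θₙ` moving, `|F f|` dominates.
  have h1 : Tendsto (fun n => ∫ x, F x * (θn n x * f x) ∂μ) atTop
      (𝓝 (∫ x, F x * (θ x * f x) ∂μ)) := by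
    refine tendsto_integral_of_dominated_convergence (fun x => ‖F x * f x‖)
      (fun n => (hint n hf).1) (hF.integrable_mul hf).norm (fun n => ae_of_all _ fun x => ?_) ?_
    · rw [norm_mul, norm_mul, norm_mul]
      gcongr
      exact mul_le_of_le_one_left (norm_nonneg _) (hθ1 n x)
    · filter_upwards [hθ] with x hx
      exact (hx.mul_const _).const_mul _
  -- The error from replacing `fₙ` by `f` is controlled by Hölder, uniformly in `|θₙ| ≤ 1`.
  have h2 : Tendsto (fun n => ∫ x, F x * (θn n x * (fn n x - f x)) ∂μ) atTop (𝓝 0) := by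
    have hd : ∀ n, MemLp (fun x => fn n x - f x) p μ := fun n => (hfn n).sub hf
    have h0 : ∫ x, (0 : ℝ) ∂μ = 0 := by simp
    rw [← h0]
    refine tendsto_integral_of_L1' (fun _ => (0 : ℝ)) aestronglyMeasurable_const
      (Eventually.of_forall fun n => hint n (hd n)) ?_
    have hlim' : Tendsto (fun n => eLpNorm F q μ * eLpNorm (fun x => fn n x - f x) p μ) atTop
        (𝓝 0) := by
      simpa using ENNReal.Tendsto.const_mul hlim (Or.inr hF.eLpNorm_ne_top)
    refine tendsto_of_tendsto_of_tendsto_of_le_of_le tendsto_const_nhds hlim'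
      (fun _ => zero_le) fun n => ?_
    refine le_trans (eLpNorm_mono fun x => ?_)
      (eLpNorm_smul_le_mul_eLpNorm (hd n).1 hF.1 (r := 1))
    simp only [Pi.sub_apply, sub_zero, Pi.smul_apply', smul_eq_mul, norm_mul]
    gcongr
    exact mul_le_of_le_one_left (norm_nonneg _) (hθ1 n x)
  have h3 := h2.add h1
  rw [zero_add] at h3
  refine h3.congr fun n => ?_
  rw [← integral_add (hint n (g := fun x => fn n x - f x) ((hfn n).sub hf)) (hint n hf)]
  congr with x
  ring

theorem tendsto_integral_mul {p q : ℝ≥0∞} [hpq : q.HolderConjugate p] {F f : α → ℝ}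
    {fn : ℕ → α → ℝ} (hF : MemLp F q μ) (hf : MemLp f p μ) (hfn : ∀ n, MemLp (fn n) p μ)
    (hlim : Tendsto (fun n => eLpNorm (fun x => fn n x - f x) p μ) atTop (𝓝 0)) :
    Tendsto (fun n => ∫ x, F x * fn n x ∂μ) atTop (𝓝 (∫ x, F x * f x ∂μ)) := by
  simpa using tendsto_integral_mul_mul (θ := fun _ => 1) (θn := fun _ _ => 1) hF hf hfn hlim
    (fun _ => aestronglyMeasurable_const) (by simp) (by simp)

theorem abs_rpow_sub_two_mul_self {p : ℝ} (hp : 1 < p) (t : ℝ) :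
    |(|t| ^ (p - 2) * t)| = |t| ^ (p - 1) := by
  rw [abs_mul, abs_of_nonneg (by positivity : 0 ≤ |t| ^ (p - 2)),
    ← Real.rpow_add_one' (abs_nonneg _) (by linarith)]
  congr 1; ring

/-- `|f|^(p-2) f` belongs to the dual exponent of `p` if `f ∈ L^p`. -/
theorem MeasureTheory.MemLp.abs_rpow_sub_two_mul {p : ℝ} (hp : 1 < p) {f : α → ℝ}
    (hf : MemLp f (ENNReal.ofReal p) μ) :
    MemLp (fun x => |f x| ^ (p - 2) * f x) (ENNReal.ofReal (p / (p - 1))) μ := by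
  have h := hf.norm_rpow_div (ENNReal.ofReal (p - 1))
  rw [← ENNReal.ofReal_div_of_pos (by linarith), ENNReal.toReal_ofReal (by linarith)] at h
  refine h.of_le ?_ (ae_of_all _ fun x => ?_)
  · have := hf.1.aemeasurable
    exact (((this.norm).pow_const (p - 2)).mul this).aestronglyMeasurable
  · simp only [Real.norm_eq_abs]
    rw [abs_rpow_sub_two_mul_self hp]
    exact le_abs_self _

theorem holderConjugate_ofReal_div {p : ℝ} (hp : 1 < p) :
    (ENNReal.ofReal (p / (p - 1))).HolderConjugate (ENNReal.ofReal p) :=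
  (Real.HolderConjugate.conjExponent hp).symm.ennrealOfReal

end Limits

/-! ### Calculus of test functions and identification of weak derivatives. -/

section TestFunctions

variable {N : ℕ}

theorem IsTestFunction.continuous_partialDeriv {φ : EuclideanSpace ℝ (Fin N) → ℝ}
    (hφ : IsTestFunction φ) (i : Fin N) : Continuous (partialDeriv i φ) :=
  (hφ.1.continuous_fderiv (by simp)).clm_apply continuous_const

theorem IsTestFunction.hasCompactSupport_partialDeriv {φ : EuclideanSpace ℝ (Fin N) → ℝ}
    (hφ : IsTestFunction φ) (i : Fin N) : HasCompactSupport (partialDeriv i φ) :=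
  hφ.2.fderiv_apply ℝ _

theorem IsTestFunction.comp {φ : EuclideanSpace ℝ (Fin N) → ℝ} (hφ : IsTestFunction φ)
    {G : ℝ → ℝ} (hG : ContDiff ℝ ∞ G) (h0 : G 0 = 0) : IsTestFunction (fun x => G (φ x)) :=
  ⟨hG.comp hφ.1, hφ.2.comp_left h0⟩

theorem partialDeriv_comp {φ : EuclideanSpace ℝ (Fin N) → ℝ} (hφ : IsTestFunction φ)
    {G : ℝ → ℝ} (hG : ContDiff ℝ ∞ G) (i : Fin N) (x : EuclideanSpace ℝ (Fin N)) :
    partialDeriv i (fun x => G (φ x)) x = deriv G (φ x) * partialDeriv i φ x := by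
  have h1 : HasFDerivAt φ (fderiv ℝ φ x) x := (hφ.1.differentiable (by simp) x).hasFDerivAt
  have h2 : HasDerivAt G (deriv G (φ x)) (φ x) := (hG.differentiable (by simp) _).hasDerivAt
  have h3 : HasFDerivAt (fun x => G (φ x)) (deriv G (φ x) • fderiv ℝ φ x) x :=
    h2.comp_hasFDerivAt x h1
  rw [partialDeriv, h3.fderiv]
  rfl

theorem integral_mul_partialDeriv {φ ψ : EuclideanSpace ℝ (Fin N) → ℝ} (hφ : IsTestFunction φ)
    (hψ : IsTestFunction ψ) (i : Fin N) :
    ∫ x, φ x * partialDeriv i ψ x = - ∫ x, partialDeriv i φ x * ψ x := by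
  have hφd : Differentiable ℝ φ := hφ.1.differentiable (by simp)
  have hψd : Differentiable ℝ ψ := hψ.1.differentiable (by simp)
  refine integral_mul_fderiv_eq_neg_fderiv_mul_of_integrable
    (v := EuclideanSpace.single i (1 : ℝ)) ?_ ?_ ?_ (fun x _ => hφd x) (fun x _ => hψd x)
  · exact ((hφ.continuous_partialDeriv i).mul hψ.1.continuous).integrable_of_hasCompactSupport
      hψ.2.mul_left
  · exact (hφ.1.continuous.mul (hψ.continuous_partialDeriv i)).integrable_of_hasCompactSupport
      hφ.2.mul_right
  · exact (hφ.1.continuous.mul hψ.1.continuous).integrable_of_hasCompactSupport hφ.2.mul_right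

/-- If `φₙ → u` in `L^P` and `∂ᵢφₙ → g` in `L^p`, then `g` is the weak derivative of `u`. -/
theorem HasWeakPartialDeriv.ae_eq_of_tendsto {i : Fin N} {u d g : EuclideanSpace ℝ (Fin N) → ℝ}
    (hd : HasWeakPartialDeriv i u d) {P p : ℝ} (hP : 1 < P) (hp : 1 < p)
    {φ : ℕ → EuclideanSpace ℝ (Fin N) → ℝ} (hφ : ∀ n, IsTestFunction (φ n))
    (hu : MemLp u (ENNReal.ofReal P)) (hg : MemLp g (ENNReal.ofReal p))
    (hφu : Tendsto (fun n => eLpNorm (fun x => φ n x - u x) (ENNReal.ofReal P) volume) atTop (𝓝 0))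
    (hφg : Tendsto (fun n => eLpNorm (fun x => partialDeriv i (φ n) x - g x)
      (ENNReal.ofReal p) volume) atTop (𝓝 0)) : d =ᵐ[volume] g := by
  have := holderConjugate_ofReal_div hP
  have := holderConjugate_ofReal_div hp
  refine ae_eq_of_integral_contDiff_smul_eq hd.2.1
    (hg.locallyIntegrable (by simpa using hp.le)) fun ψ hψ hψc => ?_
  have hψt : IsTestFunction ψ := ⟨hψ, hψc⟩
  have h1 := tendsto_integral_mul (q := ENNReal.ofReal (P / (P - 1)))
    ((hψt.continuous_partialDeriv i).memLp_of_hasCompactSupport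
      (hψt.hasCompactSupport_partialDeriv i)) hu
    (fun n => (hφ n).1.continuous.memLp_of_hasCompactSupport (hφ n).2) hφu
  have h2 := tendsto_integral_mul (q := ENNReal.ofReal (p / (p - 1)))
    (hψ.continuous.memLp_of_hasCompactSupport hψc) hg
    (fun n => ((hφ n).continuous_partialDeriv i).memLp_of_hasCompactSupport
      ((hφ n).hasCompactSupport_partialDeriv i)) hφg
  -- Integration by parts for `φₙ` survives in the limit, so `g` satisfies the identity defining
  -- `d`.
  have h3 : ∀ n, ∫ x, partialDeriv i ψ x * φ n x = - ∫ x, ψ x * partialDeriv i (φ n) x := by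
    intro n
    simp_rw [mul_comm (partialDeriv i ψ _), mul_comm (ψ _)]
    exact integral_mul_partialDeriv (hφ n) hψt i
  simp_rw [h3] at h1
  have h4 := tendsto_nhds_unique h1 h2.neg
  have h5 := hd.2.2 ψ hψt
  simp_rw [mul_comm (partialDeriv i ψ _)] at h4
  rw [h5] at h4
  simp_rw [smul_eq_mul, mul_comm (ψ _) (d _)]
  exact neg_injective h4

end TestFunctions

/-! ### The equation tested with `G(u)`, and the resulting Sobolev estimate. -/

section Energy

open scoped ENNReal

variable {N : ℕ}

theorem one_lt_criticalExponent (hN : 2 ≤ N) {p : Fin N → ℝ} (hp : ∀ i, 1 < p i)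
    (hcrit : ∀ i, p i < criticalExponent p) : 1 < criticalExponent p :=
  (hp ⟨0, by omega⟩).trans (hcrit _)

/-- A member of the anisotropic Sobolev space with weak gradient `Du` is approximated by test
functions, almost everywhere and in the norm of the space. -/
theorem MemAnisotropicSobolev.exists_seq {p : Fin N → ℝ} (hP : 1 < criticalExponent p)
    (hp : ∀ i, 1 < p i) {u : EuclideanSpace ℝ (Fin N) → ℝ} (hu : MemAnisotropicSobolev p u)
    {Du : Fin N → EuclideanSpace ℝ (Fin N) → ℝ} (hDu : ∀ i, HasWeakPartialDeriv i u (Du i)) :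
    (∀ i, MemLp (Du i) (ENNReal.ofReal (p i))) ∧
    ∃ φ : ℕ → EuclideanSpace ℝ (Fin N) → ℝ, (∀ n, IsTestFunction (φ n)) ∧
      Tendsto (fun n => eLpNorm (fun x => φ n x - u x)
        (ENNReal.ofReal (criticalExponent p)) volume) atTop (𝓝 0) ∧
      (∀ᵐ x, Tendsto (fun n => φ n x) atTop (𝓝 (u x))) ∧
      ∀ i, Tendsto (fun n => eLpNorm (fun x => partialDeriv i (φ n) x - Du i x)
        (ENNReal.ofReal (p i)) volume) atTop (𝓝 0) := by
  obtain ⟨huP, φ, hφ, hφu, hg⟩ := hu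
  choose g hg hφg using hg
  have hae : ∀ i, Du i =ᵐ[volume] g i := fun i =>
    (hDu i).ae_eq_of_tendsto hP (hp i) hφ huP (hg i) hφu (hφg i)
  -- Norm convergence gives almost everywhere convergence along a subsequence, needed for `G'(φₙ) →
  -- G'(u)`.
  have hm : TendstoInMeasure volume φ atTop u :=
    tendstoInMeasure_of_tendsto_eLpNorm (p := ENNReal.ofReal (criticalExponent p))
      (by simp; linarith) (fun n => (hφ n).1.continuous.aestronglyMeasurable) huP.1 hφu
  obtain ⟨ns, hns, hlim⟩ := hm.exists_seq_tendsto_ae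
  refine ⟨fun i => (hg i).ae_eq (hae i).symm, fun n => φ (ns n), fun n => hφ _,
    hφu.comp hns.tendsto_atTop, hlim, fun i => ?_⟩
  refine ((hφg i).comp hns.tendsto_atTop).congr fun n => ?_
  refine eLpNorm_congr_ae ?_
  filter_upwards [hae i] with x hx
  simp [hx]

theorem abs_sub_le_of_deriv_mem_Icc {G : ℝ → ℝ} (hG : Differentiable ℝ G)
    (hG0 : ∀ t, 0 ≤ deriv G t) (hG1 : ∀ t, deriv G t ≤ 1) (s t : ℝ) :
    |G s - G t| ≤ |s - t| := by
  have := Convex.norm_image_sub_le_of_norm_deriv_le (s := Set.univ) (x := t) (y := s) (C := 1)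
    (fun x _ => hG x) (fun x _ => by rw [Real.norm_eq_abs, abs_of_nonneg (hG0 x)]; exact hG1 x)
    convex_univ (Set.mem_univ _) (Set.mem_univ _)
  simpa using this

theorem MeasureTheory.MemLp.comp_of_deriv_mem_Icc {α : Type*} {m : MeasurableSpace α}
    {μ : Measure α} {P : ℝ≥0∞} {u : α → ℝ} (hu : MemLp u P μ) {G : ℝ → ℝ}
    (hG : Differentiable ℝ G) (h0 : G 0 = 0)
    (hG0 : ∀ t, 0 ≤ deriv G t) (hG1 : ∀ t, deriv G t ≤ 1) : MemLp (fun x => G (u x)) P μ := by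
  refine hu.of_le (hG.continuous.comp_aestronglyMeasurable hu.1) (ae_of_all _ fun x => ?_)
  simpa [h0] using abs_sub_le_of_deriv_mem_Icc hG hG0 hG1 (u x) 0

theorem tendsto_eLpNorm_comp_sub {α : Type*} {m : MeasurableSpace α}
    {μ : Measure α} {P : ℝ≥0∞} {u : α → ℝ} {φ : ℕ → α → ℝ} {G : ℝ → ℝ}
    (hG : Differentiable ℝ G) (hG0 : ∀ t, 0 ≤ deriv G t) (hG1 : ∀ t, deriv G t ≤ 1)
    (hφ : Tendsto (fun n => eLpNorm (fun x => φ n x - u x) P μ) atTop (𝓝 0)) :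
    Tendsto (fun n => eLpNorm (fun x => G (φ n x) - G (u x)) P μ) atTop (𝓝 0) :=
  tendsto_of_tendsto_of_tendsto_of_le_of_le tendsto_const_nhds hφ (fun _ => zero_le)
    fun _ => eLpNorm_mono fun _ => abs_sub_le_of_deriv_mem_Icc hG hG0 hG1 _ _

/-- The equation tested with `G(u)`. -/
theorem sum_integral_deriv_mul_eq {p : Fin N → ℝ} (hP : 1 < criticalExponent p)
    (hp : ∀ i, 1 < p i) {u : EuclideanSpace ℝ (Fin N) → ℝ}
    (hu : MemLp u (ENNReal.ofReal (criticalExponent p)))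
    {Du : Fin N → EuclideanSpace ℝ (Fin N) → ℝ}
    (hDu : ∀ i, MemLp (Du i) (ENNReal.ofReal (p i)))
    (heq : ∀ φ : EuclideanSpace ℝ (Fin N) → ℝ, IsTestFunction φ →
        ∑ i, ∫ x, |Du i x| ^ (p i - 2) * Du i x * partialDeriv i φ x =
          ∫ x, |u x| ^ (criticalExponent p - 2) * u x * φ x)
    {φ : ℕ → EuclideanSpace ℝ (Fin N) → ℝ} (hφ : ∀ n, IsTestFunction (φ n))
    (hφu : Tendsto (fun n => eLpNorm (fun x => φ n x - u x)
        (ENNReal.ofReal (criticalExponent p)) volume) atTop (𝓝 0))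
    (hae : ∀ᵐ x, Tendsto (fun n => φ n x) atTop (𝓝 (u x)))
    (hφD : ∀ i, Tendsto (fun n => eLpNorm (fun x => partialDeriv i (φ n) x - Du i x)
        (ENNReal.ofReal (p i)) volume) atTop (𝓝 0))
    {G : ℝ → ℝ} (hG : ContDiff ℝ ∞ G) (h0 : G 0 = 0) (hG0 : ∀ t, 0 ≤ deriv G t)
    (hG1 : ∀ t, deriv G t ≤ 1) :
    ∑ i, ∫ x, |Du i x| ^ (p i - 2) * Du i x * (deriv G (u x) * Du i x) =
      ∫ x, |u x| ^ (criticalExponent p - 2) * u x * G (u x) := by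
  have hGd : Differentiable ℝ G := hG.differentiable (by simp)
  have hGc : Continuous (deriv G) := hG.continuous_deriv (by simp)
  have h1 : ∀ i, Tendsto (fun n => ∫ x, |Du i x| ^ (p i - 2) * Du i x *
      (deriv G (φ n x) * partialDeriv i (φ n) x)) atTop
      (𝓝 (∫ x, |Du i x| ^ (p i - 2) * Du i x * (deriv G (u x) * Du i x))) := by
    intro i
    have := holderConjugate_ofReal_div (hp i)
    refine tendsto_integral_mul_mul (q := ENNReal.ofReal (p i / (p i - 1)))
      ((hDu i).abs_rpow_sub_two_mul (hp i)) (hDu i)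
      (fun n => ((hφ n).continuous_partialDeriv i).memLp_of_hasCompactSupport
        ((hφ n).hasCompactSupport_partialDeriv i)) (hφD i)
      (fun n => (hGc.comp (hφ n).1.continuous).aestronglyMeasurable)
      (fun n x => by rw [abs_of_nonneg (hG0 _)]; exact hG1 _) ?_
    filter_upwards [hae] with x hx
    exact (hGc.tendsto _).comp hx
  have h2 : Tendsto (fun n => ∫ x, |u x| ^ (criticalExponent p - 2) * u x * G (φ n x)) atTop
      (𝓝 (∫ x, |u x| ^ (criticalExponent p - 2) * u x * G (u x))) := by
    have := holderConjugate_ofReal_div hP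
    exact tendsto_integral_mul (hu.abs_rpow_sub_two_mul hP)
      (hu.comp_of_deriv_mem_Icc hGd h0 hG0 hG1)
      (fun n => ((hφ n).comp hG h0).1.continuous.memLp_of_hasCompactSupport
        ((hφ n).comp hG h0).2) (tendsto_eLpNorm_comp_sub hGd hG0 hG1 hφu)
  -- For each `n` the two sequences agree: this is the equation tested with `G(φₙ)`.
  refine tendsto_nhds_unique (tendsto_finsetSum _ fun i _ => h1 i) (h2.congr fun n => ?_)
  rw [← heq _ ((hφ n).comp hG h0)]
  simp_rw [partialDeriv_comp (hφ n) hG]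

/-- Holds because `θ^p ≤ θ` on `[0,1]`. Used with `θ = G'(φₙ)`: Sobolev's inequality produces
`(G')^p`, whereas the tested equation controls only the first power of `G'`. -/
theorem eLpNorm_mul_le_lintegral_rpow {α : Type*} {m : MeasurableSpace α} {μ : Measure α}
    {p : ℝ} (hp : 1 < p) {θ f : α → ℝ} (hθ0 : ∀ x, 0 ≤ θ x) (hθ1 : ∀ x, θ x ≤ 1) :
    eLpNorm (fun x => θ x * f x) (ENNReal.ofReal p) μ ≤
      (∫⁻ x, ENNReal.ofReal (|f x| ^ (p - 2) * f x * (θ x * f x)) ∂μ) ^ (1 / p) := by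
  have hp0 : 0 < p := by linarith
  rw [eLpNorm_eq_lintegral_rpow_enorm_toReal (by simpa using hp0) (by simp),
    ENNReal.toReal_ofReal hp0.le]
  gcongr with x
  rw [← ofReal_norm, ENNReal.ofReal_rpow_of_nonneg (norm_nonneg _) hp0.le]
  refine ENNReal.ofReal_le_ofReal ?_
  have h1 : |f x| ^ (p - 2) * f x * (θ x * f x) = θ x * |f x| ^ p := by
    have : |f x| ^ p = |f x| ^ (p - 2) * |f x| * |f x| := by
      rw [← Real.rpow_add_one' (abs_nonneg _) (by linarith),
        ← Real.rpow_add_one' (abs_nonneg _) (by linarith)]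
      congr 1; ring
    rw [this, mul_assoc (_ ^ _) |f x|, abs_mul_abs_self]; ring
  rw [h1, norm_mul, Real.mul_rpow (norm_nonneg _) (norm_nonneg _), Real.norm_of_nonneg (hθ0 x)]
  have h2 : θ x ^ p ≤ θ x := by
    simpa using Real.rpow_le_rpow_of_exponent_ge_of_imp (hθ0 x) (hθ1 x) hp.le (by simp [hp0.ne'])
  exact mul_le_mul_of_nonneg_right h2 (by positivity)

/-- Sobolev's inequality for `G(u)` combined with the equation tested with `G(u)`. -/
theorem IsCriticalAnisotropicSolution.eLpNorm_comp_le (hN : 2 ≤ N) {p : Fin N → ℝ}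
    (hp : ∀ i, 1 < p i) (hsum : 1 < ∑ i, 1 / p i) (hcrit : ∀ i, p i < criticalExponent p)
    {u : EuclideanSpace ℝ (Fin N) → ℝ} (hu : IsCriticalAnisotropicSolution p u)
    {G : ℝ → ℝ} (hG : ContDiff ℝ ∞ G) (h0 : G 0 = 0) (hG0 : ∀ t, 0 ≤ deriv G t)
    (hG1 : ∀ t, deriv G t ≤ 1) :
    eLpNorm (fun x => G (u x)) (ENNReal.ofReal (criticalExponent p)) volume ≤
      ENNReal.ofReal (1 + criticalExponent p) *
        ∑ i, (∫⁻ x, ENNReal.ofReal (|u x| ^ (criticalExponent p - 1) * |G (u x)|)) ^ (1 / p i) := by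
  have hP := one_lt_criticalExponent hN hp hcrit
  obtain ⟨hmem, Du, hDu, heq⟩ := hu
  obtain ⟨hD, φ, hφ, hφu, hae, hφD⟩ := hmem.exists_seq hP hp hDu
  have hid := sum_integral_deriv_mul_eq hP hp hmem.1 hD heq hφ hφu hae hφD hG h0 hG0 hG1
  set P := criticalExponent p with hPdef
  have hGd : Differentiable ℝ G := hG.differentiable (by simp)
  have hGc : Continuous (deriv G) := hG.continuous_deriv (by simp)
  have hGu : MemLp (fun x => G (u x)) (ENNReal.ofReal P) :=
    hmem.1.comp_of_deriv_mem_Icc hGd h0 hG0 hG1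
  have hnn : ∀ i (θ : ℝ) x, 0 ≤ θ → 0 ≤ |Du i x| ^ (p i - 2) * Du i x * (θ * Du i x) := by
    intro i θ x hθ
    have : |Du i x| ^ (p i - 2) * Du i x * (θ * Du i x) =
      |Du i x| ^ (p i - 2) * θ * (Du i x * Du i x) := by ring
    rw [this]
    exact mul_nonneg (by positivity) (mul_self_nonneg _)
  have hint : ∀ i, Integrable fun x => |Du i x| ^ (p i - 2) * Du i x * Du i x := fun i => by
    have := holderConjugate_ofReal_div (hp i)
    exact ((hD i).abs_rpow_sub_two_mul (hp i)).integrable_mul (hD i)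
  have hum : AEStronglyMeasurable u volume := hmem.1.1
  have hintθ : ∀ i {v : EuclideanSpace ℝ (Fin N) → ℝ}, AEStronglyMeasurable v volume →
      Integrable fun x => |Du i x| ^ (p i - 2) * Du i x * (deriv G (v x) * Du i x) := by
    intro i v hv
    have := (hint i).bdd_mul (c := 1) (hGc.comp_aestronglyMeasurable hv)
      (ae_of_all _ fun x => by rw [Real.norm_of_nonneg (hG0 _)]; exact hG1 _)
    refine this.congr (ae_of_all _ fun x => ?_)
    simp only; ring
  -- the energy of `G(u)` is controlled by the right-hand side of the equation
  have hE : ∀ i, ∫⁻ x, ENNReal.ofReal (|Du i x| ^ (p i - 2) * Du i x * (deriv G (u x) * Du i x)) ≤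
      ∫⁻ x, ENNReal.ofReal (|u x| ^ (P - 1) * |G (u x)|) := by
    intro i
    -- `G` is nondecreasing with `G 0 = 0`, so `u` and `G(u)` have the same sign.
    have hr : ∀ x, |u x| ^ (P - 2) * u x * G (u x) = |u x| ^ (P - 1) * |G (u x)| := by
      intro x
      have hmono : Monotone G := monotone_of_deriv_nonneg hGd hG0
      have hsgn : 0 ≤ u x * G (u x) := by
        rcases le_total 0 (u x) with h | h
        · exact mul_nonneg h (h0 ▸ hmono h)
        · exact mul_nonneg_of_nonpos_of_nonpos h (h0 ▸ hmono h)
      rw [mul_assoc, ← abs_of_nonneg hsgn, abs_mul, ← mul_assoc,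
        ← Real.rpow_add_one' (abs_nonneg _) (by linarith)]
      congr 2; ring
    have hri : Integrable fun x => |u x| ^ (P - 2) * u x * G (u x) := by
      have := holderConjugate_ofReal_div hP
      exact (hmem.1.abs_rpow_sub_two_mul hP).integrable_mul hGu
    rw [← ofReal_integral_eq_lintegral_ofReal (hintθ i hum)
      (ae_of_all _ fun x => hnn i _ x (hG0 _))]
    simp_rw [← hr]
    rw [← ofReal_integral_eq_lintegral_ofReal hri (ae_of_all _ fun x => by
      simp only [Pi.zero_apply]; rw [hr]; positivity), ← hid]
    refine ENNReal.ofReal_le_ofReal ?_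
    -- All directional energies are nonnegative, so each is at most their sum.
    exact Finset.single_le_sum
      (f := fun i => ∫ x, |Du i x| ^ (p i - 2) * Du i x * (deriv G (u x) * Du i x))
      (fun j _ => integral_nonneg fun x => hnn j _ x (hG0 _)) (Finset.mem_univ i)
  have hElim : ∀ i, Tendsto
      (fun n => ∫⁻ x, ENNReal.ofReal (|Du i x| ^ (p i - 2) * Du i x * (deriv G (φ n x) * Du i x)))
      atTop (𝓝 (∫⁻ x,
        ENNReal.ofReal (|Du i x| ^ (p i - 2) * Du i x * (deriv G (u x) * Du i x)))) := by
    intro i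
    refine tendsto_lintegral_of_dominated_convergence'
      (fun x => ENNReal.ofReal (|Du i x| ^ (p i - 2) * Du i x * Du i x))
      (fun n => (hintθ i (hφ n).1.continuous.aestronglyMeasurable).1.aemeasurable.ennreal_ofReal)
      (fun n => ae_of_all _ fun x => ?_) ?_ ?_
    · refine ENNReal.ofReal_le_ofReal ?_
      have := hnn i (1 - deriv G (φ n x)) x (by linarith [hG1 (φ n x)])
      nlinarith
    · exact (hint i).lintegral_lt_top.ne
    · filter_upwards [hae] with x hx
      refine ENNReal.tendsto_ofReal (Tendsto.const_mul _ (Tendsto.mul_const _ ?_))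
      exact (hGc.tendsto _).comp hx
  -- Sobolev is applied to `G(φₙ)`, with its gradient split as `G'(φₙ)(∂ᵢφₙ - ∂ᵢu) + G'(φₙ)∂ᵢu`; the
  -- first part vanishes in the limit.
  have hbound : ∀ n, eLpNorm (fun x => G (u x)) (ENNReal.ofReal P) volume ≤
      eLpNorm (fun x => G (φ n x) - G (u x)) (ENNReal.ofReal P) volume +
      ENNReal.ofReal (1 + P) * ∑ i, (eLpNorm (fun x => partialDeriv i (φ n) x - Du i x)
          (ENNReal.ofReal (p i)) volume +
        (∫⁻ x, ENNReal.ofReal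
          (|Du i x| ^ (p i - 2) * Du i x * (deriv G (φ n x) * Du i x))) ^ (1 / p i)) := by
    intro n
    have hGφ := (hφ n).comp hG h0
    have hφm : AEStronglyMeasurable (φ n) volume := (hφ n).1.continuous.aestronglyMeasurable
    have h1 : eLpNorm (fun x => G (u x)) (ENNReal.ofReal P) volume ≤
        eLpNorm (fun x => G (φ n x) - G (u x)) (ENNReal.ofReal P) volume +
        eLpNorm (fun x => G (φ n x)) (ENNReal.ofReal P) volume := by
      rw [← eLpNorm_neg (fun x => G (φ n x) - G (u x))]
      refine le_trans (le_of_eq ?_) (eLpNorm_add_le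
        (hGφ.1.continuous.aestronglyMeasurable.sub hGu.1).neg hGφ.1.continuous.aestronglyMeasurable
        (by simpa using hP.le))
      congr with x
      simp
    refine h1.trans (add_le_add le_rfl
      ((eLpNorm_le_sum_eLpNorm_partialDeriv hN hp hsum hGφ).trans ?_))
    gcongr with i
    have hDm := (hD i).1
    have hdm := ((hφ n).continuous_partialDeriv i).aestronglyMeasurable (μ := volume)
    have hdG := hGc.comp_aestronglyMeasurable hφm
    calc _ = eLpNorm ((fun x => deriv G (φ n x) * (partialDeriv i (φ n) x - Du i x)) +
            fun x => deriv G (φ n x) * Du i x) (ENNReal.ofReal (p i)) volume := by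
          congr with x
          rw [partialDeriv_comp (hφ n) hG]
          simp only [Pi.add_apply]; ring
      _ ≤ _ := eLpNorm_add_le (hdG.mul (hdm.sub hDm)) (hdG.mul hDm) (by simpa using (hp i).le)
      _ ≤ _ := by
          refine add_le_add (eLpNorm_mono fun x => ?_)
            (eLpNorm_mul_le_lintegral_rpow (hp i) (fun x => hG0 _) fun x => hG1 _)
          rw [norm_mul, Real.norm_of_nonneg (hG0 _)]
          exact mul_le_of_le_one_left (norm_nonneg _) (hG1 _)
  have hlim := (tendsto_eLpNorm_comp_sub hGd hG0 hG1 hφu).add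
    (ENNReal.Tendsto.const_mul (a := ENNReal.ofReal (1 + P))
      (tendsto_finsetSum Finset.univ fun i _ => (hφD i).add ((hElim i).ennrpow_const (1 / p i)))
      (Or.inr ENNReal.ofReal_ne_top))
  refine (ge_of_tendsto' hlim hbound).trans ?_
  simp only [zero_add]
  exact mul_le_mul_right (Finset.sum_le_sum fun i _ =>
    ENNReal.rpow_le_rpow (hE i) (one_div_nonneg.2 (by linarith [hp i]))) _

end Energy

/-! ### De Giorgi iteration for the upper bound, and the lower bound on the norm. -/

section DeGiorgi

open scoped ENNReal

/-- A smooth truncation vanishing below the level `m` and dominating `t - h` above the level `h`. -/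
theorem exists_smooth_truncation {m h : ℝ} (hmh : m < h) :
    ∃ G : ℝ → ℝ, ContDiff ℝ ∞ G ∧ (∀ t ≤ m, G t = 0) ∧ (∀ t, 0 ≤ deriv G t) ∧
      (∀ t, deriv G t ≤ 1) ∧ ∀ t, h ≤ t → t - h ≤ G t := by
  -- `G` will be the primitive of `g`, which climbs from 0 at `m` to 1 at `h`.
  set g : ℝ → ℝ := fun s => Real.smoothTransition ((s - m) / (h - m)) with hg
  have hgs : ContDiff ℝ ∞ g :=
    Real.smoothTransition.contDiff.comp ((contDiff_id.sub contDiff_const).div_const _)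
  have hgi : ∀ a b, IntervalIntegrable g volume a b := fun a b =>
    hgs.continuous.intervalIntegrable a b
  have hd : ∀ t, HasDerivAt (fun t => ∫ s in m..t, g s) (g t) t := fun t =>
    hgs.continuous.integral_hasStrictDerivAt m t |>.hasDerivAt
  have hderiv : deriv (fun t => ∫ s in m..t, g s) = g := funext fun t => (hd t).deriv
  refine ⟨fun t => ∫ s in m..t, g s, ?_, fun t ht => ?_, fun t => ?_, fun t => ?_, fun t ht => ?_⟩
  · refine contDiff_infty_iff_deriv.2 ⟨fun t => (hd t).differentiableAt, ?_⟩
    rwa [hderiv]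
  · simp only
    rw [intervalIntegral.integral_congr (g := fun _ => (0 : ℝ))]
    · simp
    · intro s hs
      rw [Set.uIcc_of_ge ht] at hs
      exact Real.smoothTransition.zero_of_nonpos
        (div_nonpos_of_nonpos_of_nonneg (by linarith [hs.2]) (by linarith))
  · rw [hderiv]; exact Real.smoothTransition.nonneg _
  · rw [hderiv]; exact Real.smoothTransition.le_one _
  · simp only
    rw [← intervalIntegral.integral_add_adjacent_intervals (hgi m h) (hgi h t)]
    have h1 : 0 ≤ ∫ s in m..h, g s :=
      intervalIntegral.integral_nonneg hmh.le fun s _ => Real.smoothTransition.nonneg _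
    have h2 : ∫ s in h..t, g s = t - h := by
      rw [intervalIntegral.integral_congr (g := fun _ => (1 : ℝ))]
      · simp
      · intro s hs
        rw [Set.uIcc_of_le ht] at hs
        refine Real.smoothTransition.one_of_one_le ?_
        rw [le_div_iff₀ (by linarith)]
        linarith [hs.1]
    linarith

/-- Sequences with a superlinear recursion and a small first term tend to zero. -/
theorem exists_tendsto_zero_of_superlinear_recursion {A B r : ℝ} (hA : 0 < A) (hB : 1 < B)
    (hr : 1 < r) : ∃ δ : ℝ, 0 < δ ∧ ∀ a : ℕ → ℝ, (∀ j, 0 ≤ a j) →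
      (∀ j, a j ≤ 1 → a (j + 1) ≤ A * B ^ j * a j ^ r) → a 0 ≤ δ →
      Tendsto a atTop (𝓝 0) := by
  have hB0 : 0 < B := by linarith
  have hε : 0 < r - 1 := by linarith
  set s : ℝ := B ^ (-(1 / (r - 1))) with hs
  have hs0 : 0 < s := by positivity
  -- The ratio `s` is fixed by `B s^(r-1) = 1`, so that `B^j` cancels in the induction `a j ≤ δ
  -- s^j`; then `A δ^(r-1) ≤ s` yields the next factor `s`. The `min` with 1 in `δ` keeps `a j ≤ 1`,
  -- where the recursion is available.
  have hs1 : s < 1 := Real.rpow_lt_one_of_one_lt_of_neg hB (by simpa using hr)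
  have hsB : s ^ (r - 1) = B⁻¹ := by
    rw [hs, ← Real.rpow_mul hB0.le, ← Real.rpow_neg_one]
    congr 1; field_simp
  set δ : ℝ := min 1 ((s / A) ^ (1 / (r - 1))) with hδ
  have hδ0 : 0 < δ := lt_min one_pos (by positivity)
  have hAδ : A * δ ^ (r - 1) ≤ s := by
    have : δ ^ (r - 1) ≤ s / A := by
      calc δ ^ (r - 1) ≤ ((s / A) ^ (1 / (r - 1))) ^ (r - 1) := by
            gcongr; exact min_le_right _ _
        _ = s / A := by
            rw [← Real.rpow_mul (by positivity), one_div_mul_cancel hε.ne', Real.rpow_one]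
    calc A * δ ^ (r - 1) ≤ A * (s / A) := by gcongr
      _ = s := by field_simp
  refine ⟨δ, hδ0, fun a ha hrec h0 => ?_⟩
  have hbd : ∀ j, a j ≤ δ * s ^ j := by
    intro j
    induction j with
    | zero => simpa using h0
    | succ j ih =>
      have hsj : s ^ j ≤ 1 := pow_le_one₀ hs0.le hs1.le
      have h1 : a j ≤ 1 := ih.trans (mul_le_one₀ (min_le_left _ _) (by positivity) hsj)
      have hpow : (δ * s ^ j) ^ r = δ ^ (r - 1) * (B⁻¹) ^ j * (δ * s ^ j) := by
        have : r = (r - 1) + 1 := by ring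
        conv_lhs => rw [this]
        rw [Real.rpow_add_one (by positivity), Real.mul_rpow hδ0.le (by positivity), ← hsB,
          ← Real.rpow_natCast s, ← Real.rpow_natCast (s ^ (r - 1)), ← Real.rpow_mul hs0.le,
          ← Real.rpow_mul hs0.le, mul_comm (j : ℝ)]
      calc a (j + 1) ≤ A * B ^ j * a j ^ r := hrec j h1
        _ ≤ A * B ^ j * (δ * s ^ j) ^ r := by
            have := ha j
            gcongr
        _ = (A * δ ^ (r - 1)) * (δ * s ^ j) := by
            rw [hpow, inv_pow]; field_simp
        _ ≤ s * (δ * s ^ j) := by gcongr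
        _ = δ * s ^ (j + 1) := by ring
  have hlim : Tendsto (fun j => δ * s ^ j) atTop (𝓝 0) := by
    simpa using (tendsto_pow_atTop_nhds_zero_of_lt_one hs0.le hs1).const_mul δ
  exact tendsto_of_tendsto_of_tendsto_of_le_of_le tendsto_const_nhds hlim ha hbd

variable {N : ℕ}

/-- With finitely many directions, the strict inequalities `pᵢ < p*` hold with a uniform margin; `r`
is the superlinear exponent of all later estimates. -/
theorem exists_one_lt_le_criticalExponent_div (hN : 2 ≤ N) {p : Fin N → ℝ}
    (hp : ∀ i, 1 < p i) (hcrit : ∀ i, p i < criticalExponent p) :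
    ∃ r : ℝ, 1 < r ∧ ∀ i, r ≤ criticalExponent p / p i := by
  have : Nonempty (Fin N) := ⟨⟨0, by omega⟩⟩
  obtain ⟨i, hi⟩ := Finite.exists_min fun i => criticalExponent p / p i
  exact ⟨_, (one_lt_div (by linarith [hp i])).2 (hcrit i), hi⟩

/-- Superlinear estimate for `‖G(u)‖` in terms of the right-hand side of the equation. -/
theorem IsCriticalAnisotropicSolution.eLpNorm_comp_le_rpow (hN : 2 ≤ N) {p : Fin N → ℝ}
    (hp : ∀ i, 1 < p i) (hsum : 1 < ∑ i, 1 / p i) (hcrit : ∀ i, p i < criticalExponent p)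
    {u : EuclideanSpace ℝ (Fin N) → ℝ} (hu : IsCriticalAnisotropicSolution p u)
    {G : ℝ → ℝ} (hG : ContDiff ℝ ∞ G) (h0 : G 0 = 0) (hG0 : ∀ t, 0 ≤ deriv G t)
    (hG1 : ∀ t, deriv G t ≤ 1) {r : ℝ} (hr : ∀ i, r ≤ criticalExponent p / p i) {D y : ℝ}
    (hD : 1 ≤ D) (hy0 : 0 ≤ y) (hy1 : y ≤ 1)
    (hle : ∫⁻ x, ENNReal.ofReal (|u x| ^ (criticalExponent p - 1) * |G (u x)|) ≤
      ENNReal.ofReal (D * y ^ criticalExponent p)) :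
    eLpNorm (fun x => G (u x)) (ENNReal.ofReal (criticalExponent p)) volume ≤
      ENNReal.ofReal ((1 + criticalExponent p) * N * D * y ^ r) := by
  have hP := one_lt_criticalExponent hN hp hcrit
  refine (hu.eLpNorm_comp_le hN hp hsum hcrit hG h0 hG0 hG1).trans ?_
  set P := criticalExponent p
  have hi : ∀ i, (∫⁻ x, ENNReal.ofReal (|u x| ^ (P - 1) * |G (u x)|)) ^ (1 / p i) ≤
      ENNReal.ofReal (D * y ^ r) := by
    intro i
    have hpi : 0 < p i := by linarith [hp i]
    refine (ENNReal.rpow_le_rpow hle (by positivity)).trans ?_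
    rw [ENNReal.ofReal_rpow_of_nonneg (by positivity) (by positivity),
      Real.mul_rpow (by positivity) (by positivity), ← Real.rpow_mul hy0]
    refine ENNReal.ofReal_le_ofReal ?_
    have h1 : D ^ (1 / p i) ≤ D := by
      conv_rhs => rw [← Real.rpow_one D]
      exact Real.rpow_le_rpow_of_exponent_le hD ((div_le_one hpi).2 (hp i).le)
    have h2 : y ^ (P * (1 / p i)) ≤ y ^ r := by
      refine Real.rpow_le_rpow_of_exponent_ge_of_imp hy0 hy1 ?_ (fun _ h => absurd h (by positivity))
      rw [mul_one_div]; exact hr i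
    gcongr
  calc _ ≤ ENNReal.ofReal (1 + P) * ∑ _i : Fin N, ENNReal.ofReal (D * y ^ r) := by
        gcongr with i; exact hi i
    _ = _ := by
        rw [Finset.sum_const, Finset.card_univ, Fintype.card_fin, nsmul_eq_mul,
          ← ENNReal.ofReal_natCast, ← ENNReal.ofReal_mul (by positivity),
          ← ENNReal.ofReal_mul (by linarith)]
        congr 1; ring

theorem lintegral_ofReal_abs_rpow {α : Type*} {m : MeasurableSpace α} {μ : Measure α} {P : ℝ}
    (hP : 0 < P) {f : α → ℝ} (hf : MemLp f (ENNReal.ofReal P) μ) :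
    ∫⁻ x, ENNReal.ofReal (|f x| ^ P) ∂μ =
      ENNReal.ofReal ((eLpNorm f (ENNReal.ofReal P) μ).toReal ^ P) := by
  rw [← ENNReal.ofReal_rpow_of_nonneg ENNReal.toReal_nonneg hP.le,
    ENNReal.ofReal_toReal hf.eLpNorm_ne_top,
    eLpNorm_eq_lintegral_rpow_enorm_toReal (by simpa using hP) (by simp),
    ENNReal.toReal_ofReal hP.le, ← ENNReal.rpow_mul, one_div_mul_cancel hP.ne', ENNReal.rpow_one]
  congr with x
  rw [← ofReal_norm, ENNReal.ofReal_rpow_of_nonneg (norm_nonneg _) hP.le, Real.norm_eq_abs]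

theorem MeasureTheory.MemLp.truncation {α : Type*} {m : MeasurableSpace α} {μ : Measure α}
    {P : ℝ≥0∞} {u : α → ℝ} (hu : MemLp u P μ) {k : ℝ} (hk : 0 ≤ k) :
    MemLp (fun x => max (u x - k) 0) P μ := by
  refine hu.of_le ((hu.1.sub aestronglyMeasurable_const).sup aestronglyMeasurable_const)
    (ae_of_all _ fun x => ?_)
  rw [Real.norm_of_nonneg (le_max_right _ _), Real.norm_eq_abs]
  exact max_le ((sub_le_self _ hk).trans (le_abs_self _)) (abs_nonneg _)

/-- The Caccioppoli–Sobolev step between the levels `k < h`. -/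
theorem IsCriticalAnisotropicSolution.eLpNorm_truncation_le (hN : 2 ≤ N) {p : Fin N → ℝ}
    (hp : ∀ i, 1 < p i) (hsum : 1 < ∑ i, 1 / p i) (hcrit : ∀ i, p i < criticalExponent p)
    {u : EuclideanSpace ℝ (Fin N) → ℝ} (hu : IsCriticalAnisotropicSolution p u)
    {r : ℝ} (hr : ∀ i, r ≤ criticalExponent p / p i) {k h c : ℝ} (hk : 0 < k)
    (hkh : k < h) (hc : 2 * h ≤ c * (h - k))
    (hle : (eLpNorm (fun x => max (u x - k) 0)
      (ENNReal.ofReal (criticalExponent p)) volume).toReal ≤ 1) :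
    (eLpNorm (fun x => max (u x - h) 0) (ENNReal.ofReal (criticalExponent p)) volume).toReal ≤
      (1 + criticalExponent p) * N * c ^ criticalExponent p *
        (eLpNorm (fun x => max (u x - k) 0)
          (ENNReal.ofReal (criticalExponent p)) volume).toReal ^ r := by
  have hP := one_lt_criticalExponent hN hp hcrit
  set P := criticalExponent p
  have hmem : MemLp u (ENNReal.ofReal P) := hu.1.1
  have hc1 : 1 ≤ c := by
    by_contra hlt
    push Not at hlt
    nlinarith
  -- `G` starts at the midpoint rather than at `k`, so that `t` is comparable to `t - k` wherever `G
  -- t ≠ 0`.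
  obtain ⟨G, hG, hGm, hG0, hG1, hGh⟩ :=
    exists_smooth_truncation (m := (k + h) / 2) (h := h) (by linarith)
  have hGd : Differentiable ℝ G := hG.differentiable (by simp)
  have hpt : ∀ t, |t| ^ (P - 1) * |G t| ≤ c ^ P * |max (t - k) 0| ^ P := by
    intro t
    rcases le_or_gt t ((k + h) / 2) with ht | ht
    · rw [hGm t ht]; simp; positivity
    · have h1 : |G t| ≤ t - k := by
        have := abs_sub_le_of_deriv_mem_Icc hGd hG0 hG1 t ((k + h) / 2)
        rw [hGm _ le_rfl, sub_zero, abs_of_pos (by linarith : 0 < t - (k + h) / 2)] at this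
        linarith
      -- `t/(t-k)` decreases in `t`, and at the midpoint it equals `(k+h)/(h-k) ≤ 2h/(h-k) ≤ c`.
      have h2 : |t| ≤ c * (t - k) := by
        rw [abs_of_pos (by linarith)]
        nlinarith
      have htk : 0 < t - k := by linarith
      rw [max_eq_left htk.le, abs_of_pos htk]
      calc |t| ^ (P - 1) * |G t| ≤ (c * (t - k)) ^ (P - 1) * (c * (t - k)) := by
            have : t - k ≤ c * (t - k) := le_mul_of_one_le_left htk.le hc1
            gcongr
            · linarith
        _ = _ := by
            rw [← Real.rpow_add_one (by positivity), sub_add_cancel,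
              Real.mul_rpow (by linarith) htk.le]
  have hkey := hu.eLpNorm_comp_le_rpow hN hp hsum hcrit hG (hGm 0 (by linarith)) hG0 hG1 hr
    (D := c ^ P) (Real.one_le_rpow hc1 (by linarith)) ENNReal.toReal_nonneg hle (by
      calc _ ≤ ∫⁻ x, ENNReal.ofReal (c ^ P) * ENNReal.ofReal (|max (u x - k) 0| ^ P) := by
            refine lintegral_mono fun x => ?_
            rw [← ENNReal.ofReal_mul (by positivity)]
            exact ENNReal.ofReal_le_ofReal (hpt _)
        _ = _ := by
            rw [lintegral_const_mul' _ _ ENNReal.ofReal_ne_top,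
              lintegral_ofReal_abs_rpow (by linarith) (hmem.truncation hk.le),
              ← ENNReal.ofReal_mul (by positivity)])
  refine ENNReal.toReal_le_of_le_ofReal (by positivity) (le_trans (eLpNorm_mono fun x => ?_) hkey)
  rw [Real.norm_of_nonneg (le_max_right _ _), Real.norm_eq_abs]
  refine max_le ?_ (abs_nonneg _)
  rcases le_total h (u x) with hx | hx
  · exact (hGh _ hx).trans (le_abs_self _)
  · exact le_trans (by linarith) (abs_nonneg _)

/-- Dominated convergence: the truncations are at most `|u|` and vanish eventually at each point.
This supplies the starting level of the iteration. -/
theorem tendsto_eLpNorm_truncation {α : Type*} {m : MeasurableSpace α} {μ : Measure α}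
    {P : ℝ} (hP : 0 < P) {u : α → ℝ} (hu : MemLp u (ENNReal.ofReal P) μ) :
    Tendsto (fun n : ℕ => (eLpNorm (fun x => max (u x - n) 0) (ENNReal.ofReal P) μ).toReal) atTop
      (𝓝 0) := by
  have h1 : Tendsto (fun n : ℕ => ∫⁻ x, ENNReal.ofReal (|max (u x - n) 0| ^ P) ∂μ) atTop
      (𝓝 (∫⁻ _, 0 ∂μ)) := by
    refine tendsto_lintegral_of_dominated_convergence' (fun x => ENNReal.ofReal (|u x| ^ P))
      (fun n => ?_) (fun n => ae_of_all _ fun x => ?_) ?_ (ae_of_all _ fun x => ?_)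
    · exact ((hu.truncation (Nat.cast_nonneg n)).1.aemeasurable.norm.pow_const P).ennreal_ofReal
    · refine ENNReal.ofReal_le_ofReal (Real.rpow_le_rpow (abs_nonneg _) ?_ hP.le)
      rw [abs_of_nonneg (le_max_right _ _)]
      exact max_le ((sub_le_self _ (Nat.cast_nonneg n)).trans (le_abs_self _)) (abs_nonneg _)
    · rw [lintegral_ofReal_abs_rpow hP hu]; exact ENNReal.ofReal_ne_top
    · refine tendsto_const_nhds.congr' ?_
      obtain ⟨M, hM⟩ := exists_nat_ge (u x)
      filter_upwards [eventually_ge_atTop M] with n hn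
      have : u x ≤ n := hM.trans (by exact_mod_cast hn)
      rw [max_eq_right (by linarith), abs_zero, Real.zero_rpow hP.ne', ENNReal.ofReal_zero]
  rw [lintegral_zero] at h1
  have h2 := h1.ennrpow_const (1 / P)
  rw [ENNReal.zero_rpow_of_pos (by positivity)] at h2
  replace h2 := (ENNReal.tendsto_toReal ENNReal.zero_ne_top).comp h2
  rw [ENNReal.toReal_zero] at h2
  refine h2.congr fun n => ?_
  simp only [Function.comp_apply]
  rw [lintegral_ofReal_abs_rpow hP (hu.truncation (Nat.cast_nonneg n)),
    ENNReal.ofReal_rpow_of_nonneg (by positivity) (by positivity),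
    ENNReal.toReal_ofReal (by positivity), ← Real.rpow_mul ENNReal.toReal_nonneg,
    mul_one_div_cancel hP.ne', Real.rpow_one]

/-- Solutions are bounded above. -/
theorem IsCriticalAnisotropicSolution.exists_ae_le (hN : 2 ≤ N) {p : Fin N → ℝ}
    (hp : ∀ i, 1 < p i) (hsum : 1 < ∑ i, 1 / p i) (hcrit : ∀ i, p i < criticalExponent p)
    {u : EuclideanSpace ℝ (Fin N) → ℝ} (hu : IsCriticalAnisotropicSolution p u) :
    ∃ M : ℝ, ∀ᵐ x, u x ≤ M := by
  have hP := one_lt_criticalExponent hN hp hcrit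
  obtain ⟨r, hr1, hr⟩ := exists_one_lt_le_criticalExponent_div hN hp hcrit
  have hstep := fun (k h c : ℝ) (hk : 0 < k) =>
    hu.eLpNorm_truncation_le hN hp hsum hcrit hr (k := k) (h := h) (c := c) hk
  set P := criticalExponent p
  have hmem : MemLp u (ENNReal.ofReal P) := hu.1.1
  set X : ℝ → ℝ := fun k => (eLpNorm (fun x => max (u x - k) 0) (ENNReal.ofReal P) volume).toReal
    with hX
  have hN0 : (0 : ℝ) < N := by positivity
  -- The step from level `j` will use `c = 8 * 2^j`, whence `c^P = 8^P (2^P)^j`. The threshold `δ`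
  -- is fixed before the level `K`.
  obtain ⟨δ, hδ, hrec⟩ := exists_tendsto_zero_of_superlinear_recursion
    (A := (1 + P) * N * 8 ^ P) (B := 2 ^ P) (r := r) (by positivity)
    (Real.one_lt_rpow one_lt_two (by linarith)) hr1
  obtain ⟨n, hn, hn0⟩ := (((tendsto_eLpNorm_truncation (by linarith) hmem).eventually_lt_const
    hδ).and (eventually_gt_atTop 0)).exists
  set K : ℝ := (n : ℝ)
  have hK : 0 < K := Nat.cast_pos.2 hn0
  set κ : ℕ → ℝ := fun j => K * (2 - (1 / 2) ^ j) with hκ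
  have hhalf : ∀ j, 0 < ((1 : ℝ) / 2) ^ j ∧ ((1 : ℝ) / 2) ^ j ≤ 1 := fun j =>
    ⟨by positivity, pow_le_one₀ (by norm_num) (by norm_num)⟩
  have hκ0 : ∀ j, 0 < κ j := fun j => mul_pos hK (by linarith [(hhalf j).2])
  have hκ2 : ∀ j, κ j ≤ 2 * K := fun j => by
    simp only [hκ]; nlinarith [(hhalf j).1]
  have hdiff : ∀ j, κ (j + 1) - κ j = K * (1 / 2) ^ (j + 1) := fun j => by
    simp only [hκ]; ring
  have hlim : Tendsto (fun j => X (κ j)) atTop (𝓝 0) := by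
    refine hrec _ (fun j => ENNReal.toReal_nonneg) (fun j hj => ?_) ?_
    · refine (hstep (κ j) (κ (j + 1)) (8 * 2 ^ j) (hκ0 j) ?_ ?_ hj).trans_eq ?_
      · have := hdiff j
        have : 0 < K * (1 / 2) ^ (j + 1) := by positivity
        linarith
      · rw [hdiff]
        have : (8 : ℝ) * 2 ^ j * (K * (1 / 2) ^ (j + 1)) = 4 * K := by
          rw [one_div, inv_pow]; field_simp; ring
        rw [this]
        linarith [hκ2 (j + 1)]
      · rw [Real.mul_rpow (by norm_num) (by positivity), ← Real.rpow_natCast 2 j,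
          ← Real.rpow_natCast (2 ^ P) j, ← Real.rpow_mul (by norm_num),
          ← Real.rpow_mul (by norm_num), mul_comm (j : ℝ)]
        ring
    · have : κ 0 = K := by simp only [hκ]; norm_num
      rw [this]; exact hn.le
  -- All levels stay below `2K`, so `X (2K) ≤ X (κ j)` for every `j`.
  have hzero : X (2 * K) ≤ 0 := by
    refine ge_of_tendsto' hlim fun j => ?_
    refine ENNReal.toReal_mono (hmem.truncation (hκ0 j).le).eLpNorm_ne_top
      (eLpNorm_mono fun x => ?_)
    rw [Real.norm_of_nonneg (le_max_right _ _), Real.norm_of_nonneg (le_max_right _ _)]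
    have := hκ2 j
    gcongr
  have hm := hmem.truncation (k := 2 * K) (by positivity)
  have h0 : eLpNorm (fun x => max (u x - 2 * K) 0) (ENNReal.ofReal P) volume = 0 :=
    ((ENNReal.toReal_eq_zero_iff _).1 (le_antisymm hzero ENNReal.toReal_nonneg)).resolve_right
      hm.eLpNorm_ne_top
  rw [eLpNorm_eq_zero_iff hm.1 (by simp; linarith)] at h0
  refine ⟨2 * K, ?_⟩
  filter_upwards [h0] with x hx
  have := (le_max_left (u x - 2 * K) 0).trans_eq hx
  simpa using this

/-- Nontrivial solutions have norm bounded below. -/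
theorem exists_pos_le_eLpNorm (hN : 2 ≤ N) {p : Fin N → ℝ} (hp : ∀ i, 1 < p i)
    (hsum : 1 < ∑ i, 1 / p i) (hcrit : ∀ i, p i < criticalExponent p) :
    ∃ τ₀ : ℝ, 0 < τ₀ ∧ ∀ u : EuclideanSpace ℝ (Fin N) → ℝ,
      IsCriticalAnisotropicSolution p u → ¬ (∀ᵐ x, u x = 0) →
        ENNReal.ofReal τ₀ ≤ eLpNorm u (ENNReal.ofReal (criticalExponent p)) volume := by
  have hP := one_lt_criticalExponent hN hp hcrit
  obtain ⟨r, hr1, hr⟩ := exists_one_lt_le_criticalExponent_div hN hp hcrit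
  -- The choice `G = id` tests the equation with `u` itself, and the right-hand side is exactly
  -- `y^P`.
  have hest := fun (u : EuclideanSpace ℝ (Fin N) → ℝ) (hu : IsCriticalAnisotropicSolution p u) =>
    hu.eLpNorm_comp_le_rpow hN hp hsum hcrit (G := id) contDiff_id rfl (by simp) (by simp) hr
      (D := 1) (y := (eLpNorm u (ENNReal.ofReal (criticalExponent p)) volume).toReal) le_rfl
      ENNReal.toReal_nonneg
  set P := criticalExponent p
  have hN0 : (0 : ℝ) < N := by positivity
  set A : ℝ := (1 + P) * N with hA
  have hA0 : 0 < A := by positivity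
  refine ⟨min 1 (A⁻¹ ^ (1 / (r - 1))), lt_min one_pos (by positivity), fun u hu hne => ?_⟩
  have hmem : MemLp u (ENNReal.ofReal P) := hu.1.1
  set y := (eLpNorm u (ENNReal.ofReal P) volume).toReal with hy
  rw [← ENNReal.ofReal_toReal hmem.eLpNorm_ne_top]
  refine ENNReal.ofReal_le_ofReal ?_
  by_contra hlt
  push Not at hlt
  rw [← hy, lt_min_iff] at hlt
  have hy0 : 0 < y := by
    refine ENNReal.toReal_pos (fun h => hne ?_) hmem.eLpNorm_ne_top
    rwa [eLpNorm_eq_zero_iff hmem.1 (by simp; linarith)] at h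
  have h1 : y ≤ A * y ^ r := by
    refine ENNReal.toReal_le_of_le_ofReal (by positivity) ?_
    have := hest u hu hlt.1.le (by
      rw [one_mul, ← lintegral_ofReal_abs_rpow (by linarith) hmem]
      refine lintegral_mono fun x => ENNReal.ofReal_le_ofReal ?_
      simp only [id]
      rw [← Real.rpow_add_one' (abs_nonneg _) (by linarith), sub_add_cancel])
    simpa using this
  -- Below the threshold `A y^(r-1) < 1`, which contradicts `y ≤ A y^r` for `y > 0`.
  have h2 : y ^ (r - 1) < A⁻¹ := by
    calc y ^ (r - 1) < (A⁻¹ ^ (1 / (r - 1))) ^ (r - 1) :=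
          Real.rpow_lt_rpow hy0.le hlt.2 (by linarith)
      _ = A⁻¹ := by
          rw [← Real.rpow_mul (by positivity), one_div_mul_cancel (by linarith), Real.rpow_one]
  have h3 : y ^ r = y ^ (r - 1) * y := by
    rw [← Real.rpow_add_one hy0.ne', sub_add_cancel]
  have h4 : A * y ^ r < y := by
    calc A * y ^ r = (A * y ^ (r - 1)) * y := by rw [h3]; ring
      _ < (A * A⁻¹) * y := by gcongr
      _ = y := by rw [mul_inv_cancel₀ hA0.ne', one_mul]
  linarith

end DeGiorgi

theorem proposition2 (N : ℕ) (hN : 2 ≤ N) (p : Fin N → ℝ) (hp : ∀ i, 1 < p i)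
    (hsum : 1 < ∑ i, 1 / p i) (hcrit : ∀ i, p i < criticalExponent p) :
    (∀ u : EuclideanSpace ℝ (Fin N) → ℝ, IsCriticalAnisotropicSolution p u →
      (∀ᵐ x, 0 ≤ u x) → MemLp u ⊤) ∧
    ∃ τ₀ : ℝ, 0 < τ₀ ∧ ∀ u : EuclideanSpace ℝ (Fin N) → ℝ,
      IsCriticalAnisotropicSolution p u → ¬ (∀ᵐ x, u x = 0) →
        ENNReal.ofReal τ₀ ≤ eLpNorm u (ENNReal.ofReal (criticalExponent p)) volume := by
  refine ⟨fun u hu hu0 => ?_, exists_pos_le_eLpNorm hN hp hsum hcrit⟩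
  -- The upper bound holds for solutions of any sign; nonnegativity only turns it into a bound on
  -- `|u|`.
  obtain ⟨M, hM⟩ := hu.exists_ae_le hN hp hsum hcrit
  refine memLp_top_of_bound hu.1.1.1 M ?_
  filter_upwards [hu0, hM] with x h0 h1
  rwa [Real.norm_of_nonneg h0]
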